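/- Let $N\simeq\mathbb{Z}^n$ be a lattice and $N_{\mathbb{R}}=N\otimes\mathbb{R}$. A *polyhedron* in a finite-dimensional real vector space is an intersection of finitely many closed halfspaces; it is *strongly convex* if it contains no line, *rational* (with respect to a lattice, $N$ for $N_{\mathbb{R}}$ and $N\times\mathbb{Z}$ for $N_{\mathbb{R}}\times\mathbb{R}$) if the halfspaces can be defined by inequalities with rational coefficients, and a *cone* if it is non-empty and stable under multiplication by non-negative scalars. A *face* of a polyhedron $\Lambda$ is a non-empty subset of the form $\{u\in\Lambda : \langle x,u\rangle\le\langle x,v\rangle \text{ for all } v\in\Lambda\}$ with $x$ a linear functional. A *polyhedral complex* is a finite non-empty collection of non-empty polyhedra that contains every face of each of its elements and in which any two elements are either disjoint or intersect in a common face. It is *rational*, *strongly convex* or *conic* if all its elements are rational, strongly convex or cones, respectively. It is *complete* in a set $E$ if the union of its elements is $E$. For a polyhedral complex $\Pi$ in $N_{\mathbb{R}}$ put $$\operatorname{c}(\Pi)=\{\operatorname{c}(\Lambda) : \Lambda\in\Pi\}\cup\{\operatorname{rec}(\Lambda)\times\{0\} : \Lambda\in\Pi\},$$ where $\operatorname{c}(\Lambda)=\overline{\mathbb{R}_{>0}(\Lambda\times\{1\})}\subset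 N_{\mathbb{R}}\times\mathbb{R}_{\ge0}$ and $\operatorname{rec}(\Lambda)=\{u\in N_{\mathbb{R}} : p+\lambda u\in\Lambda \text{ for all } p\in\Lambda,\ \lambda\ge0\}$. For a conic polyhedral complex $\Sigma$ in $N_{\mathbb{R}}\times\mathbb{R}_{\ge0}$ let $\operatorname{aff}(\Sigma)$ be the collection of the non-empty intersections $\sigma\cap(N_{\mathbb{R}}\times\{1\})$, $\sigma\in\Sigma$, regarded as subsets of $N_{\mathbb{R}}$. **Corollary.** The map $\Pi\mapsto\operatorname{c}(\Pi)$ is a bijection from the set of complete polyhedral complexes in $N_{\mathbb{R}}$ to the set of complete conic polyhedral complexes in $N_{\mathbb{R}}\times\mathbb{R}_{\ge0}$. Its inverse is $\Sigma\mapsto\operatorname{aff}(\Sigma)$. Both maps preserve rationality and strong convexity. -/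

import Mathlib

namespace PolyComplex

/-- The solution set of the system of inequalities `b ≤ ⟨x, u⟩`, one for each pair `(x, b)` in `H`.
Each inequality with `x ≠ 0` is a closed halfspace; one with `x = 0` is trivial if the solution
set is non-empty, and may then be dropped. -/
def solutionSet {V : Type*} [AddCommGroup V] [Module ℝ V]
    (H : Finset (Module.Dual ℝ V × ℝ)) : Set V :=
  {u | ∀ h ∈ H, h.2 ≤ h.1 u}

/-- A polyhedron: an intersection of finitely many closed halfspaces. -/
def IsPolyhedron {V : Type*} [AddCommGroup V] [Module ℝ V] (P : Set V) : Prop :=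
  ∃ H : Finset (Module.Dual ℝ V × ℝ), P = solutionSet H

/-- A linear functional is rational with respect to the lattice `N` if it takes rational values
on `N`, that is, if its coefficients in a basis of `N` are rational. -/
def IsRationalFunctional {V : Type*} [AddCommGroup V] [Module ℝ V] (N : Submodule ℤ V)
    (x : Module.Dual ℝ V) : Prop :=
  ∀ u ∈ N, ∃ q : ℚ, x u = (q : ℝ)

/-- A polyhedron is rational if it can be defined by inequalities with rational coefficients
(the constant terms included). -/
def IsRationalPolyhedron {V : Type*} [AddCommGroup V] [Module ℝ V] (N : Submodule ℤ V)
    (P : Set V) : Prop :=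
  ∃ H : Finset (Module.Dual ℝ V × ℝ),
    (∀ h ∈ H, IsRationalFunctional N h.1 ∧ ∃ q : ℚ, h.2 = (q : ℝ)) ∧ P = solutionSet H

/-- A set is strongly convex, in the sense used for polyhedra, if it contains no line. -/
def ContainsNoLine {V : Type*} [AddCommGroup V] [Module ℝ V] (P : Set V) : Prop :=
  ¬ ∃ p v : V, v ≠ 0 ∧ ∀ t : ℝ, p + t • v ∈ P

/-- A cone: a non-empty set stable under multiplication by non-negative scalars. -/
def IsConic {V : Type*} [AddCommGroup V] [Module ℝ V] (P : Set V) : Prop :=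
  P.Nonempty ∧ ∀ r : ℝ, 0 ≤ r → ∀ u ∈ P, r • u ∈ P

/-- A face of `P`: a non-empty subset on which some linear functional attains its minimum
over `P`. The functional `0` gives `P` itself. -/
def IsFace {V : Type*} [AddCommGroup V] [Module ℝ V] (F P : Set V) : Prop :=
  F.Nonempty ∧ ∃ x : Module.Dual ℝ V, F = {u | u ∈ P ∧ ∀ v ∈ P, x u ≤ x v}

/-- A polyhedral complex: a finite non-empty collection of non-empty polyhedra which contains the
faces of its elements, and such that any two elements are disjoint or meet in a common face. -/
structure IsPolyhedralComplex {V : Type*} [AddCommGroup V] [Module ℝ V]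
    (C : Set (Set V)) : Prop where
  finite : C.Finite
  nonempty : C.Nonempty
  isPolyhedron : ∀ P ∈ C, IsPolyhedron P
  nonempty_of_mem : ∀ P ∈ C, P.Nonempty
  face_mem : ∀ P ∈ C, ∀ F : Set V, IsFace F P → F ∈ C
  inter : ∀ P ∈ C, ∀ Q ∈ C, Disjoint P Q ∨ (IsFace (P ∩ Q) P ∧ IsFace (P ∩ Q) Q)

/-- A conic polyhedral complex: all elements are cones. -/
def IsConicComplex {V : Type*} [AddCommGroup V] [Module ℝ V] (C : Set (Set V)) : Prop :=
  IsPolyhedralComplex C ∧ ∀ P ∈ C, IsConic P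

/-- A collection of polyhedra is rational if all its elements are. -/
def IsRationalCollection {V : Type*} [AddCommGroup V] [Module ℝ V] (N : Submodule ℤ V)
    (C : Set (Set V)) : Prop :=
  ∀ P ∈ C, IsRationalPolyhedron N P

/-- A collection of polyhedra is strongly convex if all its elements are. -/
def IsStronglyConvexCollection {V : Type*} [AddCommGroup V] [Module ℝ V]
    (C : Set (Set V)) : Prop :=
  ∀ P ∈ C, ContainsNoLine P

/-- The support of a collection of sets. -/
def support {V : Type*} (C : Set (Set V)) : Set V :=
  ⋃ P ∈ C, P

/-- The complete polyhedral complexes in `V`. -/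
def completeComplexes (V : Type*) [AddCommGroup V] [Module ℝ V] : Set (Set (Set V)) :=
  {C | IsPolyhedralComplex C ∧ support C = Set.univ}

/-- The complete conic polyhedral complexes in `V × ℝ_{≥ 0}`: conic polyhedral complexes in the
vector space `V × ℝ` whose support is the halfspace `V × ℝ_{≥ 0}`. -/
def completeConicComplexes (V : Type*) [AddCommGroup V] [Module ℝ V] :
    Set (Set (Set (V × ℝ))) :=
  {S | IsConicComplex S ∧ support S = Set.univ ×ˢ Set.Ici (0 : ℝ)}

/-- The local recession cone of `E` at `p`. -/
def localRecessionCone {V : Type*} [AddCommGroup V] [Module ℝ V] (E : Set V) (p : V) : Set V :=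
  {u | ∀ r : ℝ, 0 ≤ r → p + r • u ∈ E}

/-- The recession cone of `E`. -/
def recessionCone {V : Type*} [AddCommGroup V] [Module ℝ V] (E : Set V) : Set V :=
  ⋂ p ∈ E, localRecessionCone E p

/-- The cone of `E`: the closure of `ℝ_{> 0} (E × {1})` in `V × ℝ`. -/
def coneOver {V : Type*} [AddCommGroup V] [Module ℝ V] [TopologicalSpace V] (E : Set V) :
    Set (V × ℝ) :=
  closure {z | ∃ r : ℝ, 0 < r ∧ ∃ u ∈ E, z = r • (u, (1 : ℝ))}

/-- The recession of a collection of polyhedra. -/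
def recessionComplex {V : Type*} [AddCommGroup V] [Module ℝ V] (C : Set (Set V)) :
    Set (Set V) :=
  recessionCone '' C

/-- The cone of a collection of polyhedra: the cones of its elements, and the recession cones of
its elements placed at height `0`. -/
def coneComplex {V : Type*} [AddCommGroup V] [Module ℝ V] [TopologicalSpace V]
    (C : Set (Set V)) : Set (Set (V × ℝ)) :=
  (coneOver '' C) ∪ ((fun s : Set V => s ×ˢ ({0} : Set ℝ)) '' recessionComplex C)

/-- The collection of non-empty intersections of elements of `S` with the hyperplane `V × {1}`,
which is identified with `V`. -/
def affComplex {V : Type*} (S : Set (Set (V × ℝ))) : Set (Set V) :=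
  {P | P.Nonempty ∧ ∃ s ∈ S, P = {u | (u, (1 : ℝ)) ∈ s}}

/-- The lattice `N × ℤ` in `V × ℝ`. -/
def prodLattice {V : Type*} [AddCommGroup V] (N : Submodule ℤ V) : Submodule ℤ (V × ℝ) :=
  N.prod (Submodule.span ℤ {(1 : ℝ)})

end PolyComplex

namespace PolyComplex

open Filter Topology

/-! ### Recession cones of polyhedra -/

section Algebra

variable {V : Type*} [AddCommGroup V] [Module ℝ V]

/-! A point `(u, t)` of the cone over a non-empty polyhedron `P` either has `t > 0` and `u / t ∈ P`,
or has `t = 0` and `u` in the recession cone of `P` (`mem_coneOver`). So the slice at height one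
recovers `P`, and a polyhedral cone in the upper halfspace that meets height one is the cone over
its slice (`coneOver_slice`). Faces correspond too: those of the cone over `P` are the cones over
faces `F` of `P` and the sets `rec F × {0}` (`exists_of_isFace_coneOver`).

The real content lies at height zero. Cones over disjoint cells meet in `(rec P ∩ rec Q) × {0}`,
which need not be a face unless the complex is complete. An extreme convex subcone of a polyhedral
cone is a face (`isFace_of_extreme`), so it suffices that `a, b ∈ rec P` and `a + b ∈ rec Q` force
`a, b ∈ rec Q` (`mem_recessionCone_of_add_mem`). Put `w = a + b`. The tubes `R + ℝw`, over cells `R`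
with `w ∈ rec R`, are closed, finite in number, and cover the space. If some of these cells have `a`
and `b` as recession directions and others do not, connectedness makes tubes of the two kinds meet.
Far out in direction `w` the two cells then meet, necessarily in a common face, whose recession cone
contains `w` and hence `a` and `b`, a contradiction.

In the other direction, a cone of the conic complex that misses height one has a generic point lying
in the cone over some slice. It is therefore a face of that cone and has the form `rec F × {0}`
(`coneComplex_affComplex`). Rationality is read off from explicit systems of inequalities, and
strong convexity from opposite recession directions. -/

theorem eventually_add_smul_mem_solutionSet {H : Finset (Module.Dual ℝ V × ℝ)} {q w : V}
    (hw : ∀ h ∈ H, 0 ≤ h.1 w) (hq : ∀ h ∈ H, h.1 w = 0 → h.2 ≤ h.1 q) :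
    ∀ᶠ r : ℝ in atTop, q + r • w ∈ solutionSet H := by
  simp only [solutionSet, Set.mem_ofPred_eq]
  rw [Filter.eventually_all_finset]
  intro h hh
  rcases (hw h hh).eq_or_lt with h0 | h0
  · filter_upwards with r
    simpa [← h0] using hq h hh h0.symm
  · filter_upwards [eventually_ge_atTop ((h.2 - h.1 q) / h.1 w)] with r hr
    rw [div_le_iff₀ h0] at hr
    simp only [map_add, map_smul, smul_eq_mul]
    linarith

theorem nonneg_of_frequently_add_smul_mem {H : Finset (Module.Dual ℝ V × ℝ)} {q w : V}
    (hf : ∃ᶠ r : ℝ in atTop, q + r • w ∈ solutionSet H) : ∀ h ∈ H, 0 ≤ h.1 w := by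
  intro h hh
  by_contra! h0
  refine hf ?_
  filter_upwards [eventually_gt_atTop ((h.2 - h.1 q) / h.1 w)] with r hr hm
  have := hm h hh
  simp only [map_add, map_smul, smul_eq_mul] at this
  rw [div_lt_iff_of_neg h0] at hr
  linarith

/-- A constraint negative on `w` would eventually fail along the ray. Unboundedly many points on one
ray thus suffice, which permits a pigeonhole over finitely many cells. -/
theorem mem_recessionCone_of_frequently {P : Set V} (hP : IsPolyhedron P) {q w : V}
    (hf : ∃ᶠ r : ℝ in atTop, q + r • w ∈ P) : w ∈ recessionCone P := by
  obtain ⟨H, rfl⟩ := hP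
  have hw := nonneg_of_frequently_add_smul_mem hf
  simp only [recessionCone, Set.mem_iInter]
  intro p hp r hr h hh
  simp only [map_add, map_smul, smul_eq_mul]
  nlinarith [hp h hh, mul_nonneg hr (hw h hh)]

theorem mem_recessionCone_iff_of_mem {P : Set V} (hP : IsPolyhedron P) {p : V} (hp : p ∈ P)
    (u : V) : u ∈ recessionCone P ↔ ∀ r : ℝ, 0 ≤ r → p + r • u ∈ P := by
  refine ⟨fun h => Set.mem_iInter₂.1 h p hp, fun h => ?_⟩
  refine mem_recessionCone_of_frequently hP (q := p) (Eventually.frequently ?_)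
  filter_upwards [eventually_ge_atTop 0] with r hr using h r hr

theorem add_smul_mem_of_mem_recessionCone {P : Set V} {p u : V} (hp : p ∈ P)
    (hu : u ∈ recessionCone P) {r : ℝ} (hr : 0 ≤ r) : p + r • u ∈ P :=
  Set.mem_iInter₂.1 hu p hp r hr

theorem recessionCone_solutionSet {H : Finset (Module.Dual ℝ V × ℝ)}
    (hne : (solutionSet H).Nonempty) :
    recessionCone (solutionSet H) = {u | ∀ h ∈ H, 0 ≤ h.1 u} := by
  obtain ⟨p, hp⟩ := hne
  ext u
  constructor
  · intro hu
    refine nonneg_of_frequently_add_smul_mem (q := p) (Eventually.frequently ?_)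
    filter_upwards [eventually_ge_atTop 0] with r hr
      using add_smul_mem_of_mem_recessionCone hp hu hr
  · intro hu
    rw [mem_recessionCone_iff_of_mem ⟨H, rfl⟩ hp]
    intro r hr h hh
    simp only [map_add, map_smul, smul_eq_mul]
    nlinarith [hp h hh, mul_nonneg hr (hu h hh)]

theorem zero_mem_recessionCone (P : Set V) : (0 : V) ∈ recessionCone P := by
  simp only [recessionCone, Set.mem_iInter]
  intro p hp r hr
  simpa using hp

theorem isConic_recessionCone (P : Set V) : IsConic (recessionCone P) := by
  refine ⟨⟨0, zero_mem_recessionCone P⟩, fun r hr u hu => ?_⟩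
  simp only [recessionCone, Set.mem_iInter] at hu ⊢
  intro p hp s hs
  rw [smul_smul]
  exact hu p hp _ (mul_nonneg hs hr)

theorem isPolyhedron_recessionCone {P : Set V} (hP : IsPolyhedron P) (hne : P.Nonempty) :
    IsPolyhedron (recessionCone P) := by
  classical
  obtain ⟨H, rfl⟩ := hP
  refine ⟨H.image fun h => (h.1, 0), ?_⟩
  rw [recessionCone_solutionSet hne]
  ext u
  simp only [solutionSet, Set.mem_ofPred_eq, Finset.forall_mem_image]

theorem recessionCone_mono {P Q : Set V} (hQ : IsPolyhedron Q) (hP : P.Nonempty) (h : P ⊆ Q) :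
    recessionCone P ⊆ recessionCone Q := by
  obtain ⟨p, hp⟩ := hP
  intro u hu
  rw [mem_recessionCone_iff_of_mem hQ (h hp)]
  exact fun r hr => h (add_smul_mem_of_mem_recessionCone hp hu hr)

theorem recessionCone_inter {P Q : Set V} (hP : IsPolyhedron P) (hQ : IsPolyhedron Q)
    (hne : (P ∩ Q).Nonempty) :
    recessionCone (P ∩ Q) = recessionCone P ∩ recessionCone Q := by
  refine (Set.subset_inter (recessionCone_mono hP hne Set.inter_subset_left)
    (recessionCone_mono hQ hne Set.inter_subset_right)).antisymm ?_
  rintro u ⟨hu, hu'⟩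
  simp only [recessionCone, Set.mem_iInter]
  exact fun p hp r hr => ⟨add_smul_mem_of_mem_recessionCone hp.1 hu hr,
    add_smul_mem_of_mem_recessionCone hp.2 hu' hr⟩

/-! ### Polyhedral cones and their faces -/

theorem IsConic.zero_mem {P : Set V} (hP : IsConic P) : (0 : V) ∈ P := by
  obtain ⟨p, hp⟩ := hP.1
  simpa using hP.2 0 le_rfl p hp

theorem IsConic.solutionSet_eq {H : Finset (Module.Dual ℝ V × ℝ)}
    (hP : IsConic (solutionSet H)) : solutionSet H = {u | ∀ h ∈ H, 0 ≤ h.1 u} := by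
  ext u
  constructor
  · intro hu
    refine nonneg_of_frequently_add_smul_mem (q := 0) (Eventually.frequently ?_)
    filter_upwards [eventually_ge_atTop 0] with r hr
    simpa using hP.2 r hr u hu
  · intro hu h hh
    have := hP.zero_mem h hh
    rw [map_zero] at this
    exact this.trans (hu h hh)

theorem IsConic.exists_eq {P : Set V} (hP : IsConic P) (hP' : IsPolyhedron P) :
    ∃ H : Finset (Module.Dual ℝ V × ℝ), P = {u | ∀ h ∈ H, 0 ≤ h.1 u} := by
  obtain ⟨H, rfl⟩ := hP'
  exact ⟨H, hP.solutionSet_eq⟩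

theorem IsConic.add_mem {P : Set V} (hP : IsConic P) (hP' : IsPolyhedron P) {u v : V}
    (hu : u ∈ P) (hv : v ∈ P) : u + v ∈ P := by
  obtain ⟨H, rfl⟩ := hP.exists_eq hP'
  intro h hh
  rw [map_add]
  exact add_nonneg (hu h hh) (hv h hh)

theorem IsConic.isFace_iff {P F : Set V} (hP : IsConic P) :
    IsFace F P ↔ ∃ x : Module.Dual ℝ V, (∀ v ∈ P, 0 ≤ x v) ∧ F = {u | u ∈ P ∧ x u = 0} := by
  constructor
  · rintro ⟨⟨f, hf⟩, x, rfl⟩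
    have h1 : x f ≤ 0 := by simpa using hf.2 0 hP.zero_mem
    -- Comparing `f` with `2 • f` shows that the minimum over a cone can only be zero.
    have h2 : 0 ≤ x f := by
      have := hf.2 _ (hP.2 2 (by norm_num) f hf.1)
      simp only [map_smul, smul_eq_mul] at this
      linarith
    have h0 : x f = 0 := le_antisymm h1 h2
    have hx : ∀ v ∈ P, 0 ≤ x v := fun v hv => by simpa [h0] using hf.2 v hv
    refine ⟨x, hx, ?_⟩
    ext u
    refine and_congr_right fun hu => ⟨fun h => ?_, fun h v hv => h ▸ hx v hv⟩
    exact le_antisymm (by simpa using h 0 hP.zero_mem) (hx u hu)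
  · rintro ⟨x, hx, rfl⟩
    refine ⟨⟨0, hP.zero_mem, map_zero x⟩, x, ?_⟩
    ext u
    refine and_congr_right fun hu => ⟨fun h v hv => h ▸ hx v hv, fun h => ?_⟩
    exact le_antisymm (by simpa using h 0 hP.zero_mem) (hx u hu)

/-- A convex cone has a point at which as few as possible of the given functionals vanish. -/
theorem exists_generic_mem {C : Set V} (h0 : (0 : V) ∈ C) (hadd : ∀ u ∈ C, ∀ v ∈ C, u + v ∈ C)
    (H : Finset (Module.Dual ℝ V × ℝ)) (hC : ∀ u ∈ C, ∀ h ∈ H, 0 ≤ h.1 u) :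
    ∃ c ∈ C, ∀ h ∈ H, h.1 c = 0 → ∀ v ∈ C, h.1 v = 0 := by
  classical
  induction H using Finset.induction_on with
  | empty => exact ⟨0, h0, by simp⟩
  | insert a s ha ih =>
    obtain ⟨c, hc, hcs⟩ := ih fun u hu h hh => hC u hu h (Finset.mem_insert_of_mem hh)
    -- The functionals are non-negative on `C`, so a sum of two points is a zero only where both
    -- points are: adding `d` keeps what `c` achieves on `s`.
    have key : ∀ d ∈ C, (a.1 d = 0 → ∀ v ∈ C, a.1 v = 0) →
        ∃ c ∈ C, ∀ h ∈ insert a s, h.1 c = 0 → ∀ v ∈ C, h.1 v = 0 := by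
      intro d hd hda
      refine ⟨c + d, hadd c hc d hd, fun h hh hz => ?_⟩
      have h1 := hC c hc h hh
      have h2 := hC d hd h hh
      rw [map_add] at hz
      rcases Finset.mem_insert.1 hh with rfl | hh
      · exact hda (by linarith)
      · exact hcs h hh (by linarith)
    by_cases hz : ∀ v ∈ C, a.1 v = 0
    · exact key 0 h0 fun _ => hz
    · push Not at hz
      obtain ⟨d, hd, hne⟩ := hz
      exact key d hd fun h => absurd h hne

/-- If every constraint that vanishes at `c` vanishes at `v`, then one can move from `c` in the
direction `-v` without leaving the cone. -/
theorem exists_smul_sub_nonneg {H : Finset (Module.Dual ℝ V × ℝ)} {c v : V}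
    (hc : ∀ h ∈ H, 0 ≤ h.1 c) (hv : ∀ h ∈ H, h.1 c = 0 → h.1 v = 0) :
    ∃ r : ℝ, 0 < r ∧ ∀ h ∈ H, 0 ≤ h.1 (r • c - v) := by
  classical
  -- Start at `-v` and go far in direction `c`: constraints positive on `c` win, the others vanish
  -- on both.
  have := eventually_add_smul_mem_solutionSet (H := H.image fun h => (h.1, (0 : ℝ))) (q := -v)
    (w := c) (by simpa only [Finset.forall_mem_image] using hc)
    (by
      simp only [Finset.forall_mem_image]
      intro h hh h0
      simp [hv h hh h0])
  obtain ⟨r, hr, hr0⟩ := (this.and (eventually_gt_atTop 0)).exists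
  refine ⟨r, hr0, fun h hh => ?_⟩
  have := hr (h.1, 0) (Finset.mem_image_of_mem _ hh)
  rwa [neg_add_eq_sub] at this

/-- Such a `c` plays the role of a relative interior point: for each `v ∈ P`, some `r • c - v` is
still in `P`, so a functional that is non-negative on `P` and zero at `c` is zero at `v`. -/
theorem exists_generic_mem_of_isConic {P : Set V} (hP : IsConic P) (hP' : IsPolyhedron P) :
    ∃ c ∈ P, ∀ F, IsFace F P → c ∈ F → F = P := by
  obtain ⟨H, hH⟩ := hP.exists_eq hP'
  obtain ⟨c, hc, hcH⟩ := exists_generic_mem hP.zero_mem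
    (fun u hu v hv => hP.add_mem hP' hu hv) H (fun u hu => by rw [hH] at hu; exact hu)
  refine ⟨c, hc, fun F hF hcF => ?_⟩
  obtain ⟨x, hx, rfl⟩ := hP.isFace_iff.1 hF
  refine Set.Subset.antisymm (fun u hu => hu.1) fun v hv => ⟨hv, ?_⟩
  obtain ⟨r, hr, h⟩ := exists_smul_sub_nonneg (H := H) (c := c) (v := v)
    (by rw [hH] at hc; exact hc) (fun h hh h0 => hcH h hh h0 v hv)
  have h1 := hx (r • c - v) (by rw [hH]; exact h)
  rw [map_sub, map_smul, hcF.2, smul_zero] at h1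
  linarith [hx v hv]

/-- An extreme convex subcone of a polyhedral cone is a face. -/
theorem isFace_of_extreme {P C : Set V} (hP : IsConic P) (hP' : IsPolyhedron P)
    (hCP : C ⊆ P) (hC : IsConic C) (hadd : ∀ u ∈ C, ∀ v ∈ C, u + v ∈ C)
    (hext : ∀ u ∈ P, ∀ v ∈ P, u + v ∈ C → v ∈ C) : IsFace C P := by
  classical
  obtain ⟨H, hH⟩ := hP.exists_eq hP'
  have hpos : ∀ u ∈ P, ∀ h ∈ H, 0 ≤ h.1 u := fun u hu => by rw [hH] at hu; exact hu
  obtain ⟨c, hc, hcH⟩ := exists_generic_mem hC.zero_mem hadd H fun u hu => hpos u (hCP hu)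
  rw [hP.isFace_iff]
  -- The sum of the constraints tight at a generic point of `C`; being non-negative on `P`, they
  -- vanish together exactly where their sum does.
  refine ⟨∑ h ∈ H.filter (fun h => h.1 c = 0), h.1, fun v hv => ?_, ?_⟩
  · rw [LinearMap.sum_apply]
    exact Finset.sum_nonneg fun h hh => hpos v hv h (Finset.mem_filter.1 hh).1
  · ext v
    rw [Set.mem_ofPred_eq, LinearMap.sum_apply]
    constructor
    · intro hv
      refine ⟨hCP hv, Finset.sum_eq_zero fun h hh => ?_⟩
      rw [Finset.mem_filter] at hh
      exact hcH h hh.1 hh.2 v hv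
    · rintro ⟨hv, hs⟩
      rw [Finset.sum_eq_zero_iff_of_nonneg
        fun h hh => hpos v hv h (Finset.mem_filter.1 hh).1] at hs
      obtain ⟨r, hr, h⟩ := exists_smul_sub_nonneg (H := H) (c := c) (v := v)
        (hpos c (hCP hc)) (fun h hh h0 => hs h (Finset.mem_filter.2 ⟨hh, h0⟩))
      -- `r • c ∈ C` is the sum of `r • c - v` and `v`, both in `P`, so extremality applies.
      refine hext (r • c - v) (by rw [hH]; exact h) v hv ?_
      rw [sub_add_cancel]
      exact hC.2 r hr.le c hc

/-! ### Faces and recession cones -/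

theorem recessionCone_face {P : Set V} (hP : IsPolyhedron P) {x : Module.Dual ℝ V} {m : ℝ}
    (hne : {u | u ∈ P ∧ x u = m}.Nonempty) :
    recessionCone {u | u ∈ P ∧ x u = m} = {u | u ∈ recessionCone P ∧ x u = 0} := by
  obtain ⟨f, hf⟩ := hne
  ext u
  constructor
  · intro hu
    refine ⟨(mem_recessionCone_iff_of_mem hP hf.1 u).2 fun r hr =>
      (add_smul_mem_of_mem_recessionCone hf hu hr).1, ?_⟩
    have := (add_smul_mem_of_mem_recessionCone hf hu zero_le_one).2
    rw [map_add, hf.2, one_smul] at this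
    linarith
  · rintro ⟨hu, hx⟩
    simp only [recessionCone, Set.mem_iInter]
    intro p hp r hr
    refine ⟨add_smul_mem_of_mem_recessionCone hp.1 hu hr, ?_⟩
    rw [map_add, map_smul, hx, hp.2, smul_zero, add_zero]

/-- Naming the minimum `m` turns a face into a linear section of `P`. -/
theorem isFace_iff {P F : Set V} :
    IsFace F P ↔ F.Nonempty ∧ ∃ (x : Module.Dual ℝ V) (m : ℝ), (∀ v ∈ P, m ≤ x v) ∧
      F = {u | u ∈ P ∧ x u = m} := by
  constructor
  · rintro ⟨⟨f, hf⟩, x, rfl⟩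
    refine ⟨⟨f, hf⟩, x, x f, hf.2, ?_⟩
    ext u
    refine and_congr_right fun hu => ⟨fun h => le_antisymm (h f hf.1) (hf.2 u hu), fun h => ?_⟩
    rw [h]
    exact hf.2
  · rintro ⟨⟨f, hf⟩, x, m, hm, rfl⟩
    refine ⟨⟨f, hf⟩, x, ?_⟩
    ext u
    refine and_congr_right fun hu => ⟨fun h => by rw [h]; exact hm, fun h => ?_⟩
    exact le_antisymm ((h f hf.1).trans hf.2.le) (hm u hu)

theorem IsFace.subset {P F : Set V} (hF : IsFace F P) : F ⊆ P := by
  obtain ⟨-, x, rfl⟩ := hF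
  exact fun u hu => hu.1

theorem IsFace.isPolyhedron {P F : Set V} (hF : IsFace F P) (hP : IsPolyhedron P) :
    IsPolyhedron F := by
  classical
  obtain ⟨-, x, m, -, rfl⟩ := isFace_iff.1 hF
  obtain ⟨H, rfl⟩ := hP
  refine ⟨insert (x, m) (insert (-x, -m) H), ?_⟩
  ext u
  simp only [solutionSet, Set.mem_ofPred_eq, Finset.forall_mem_insert, LinearMap.neg_apply,
    neg_le_neg_iff, le_antisymm_iff]
  tauto

theorem isFace_recessionCone {P F : Set V} (hP : IsPolyhedron P) (hF : IsFace F P) :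
    IsFace (recessionCone F) (recessionCone P) := by
  obtain ⟨hne, x, m, hm, rfl⟩ := isFace_iff.1 hF
  rw [(isConic_recessionCone P).isFace_iff]
  obtain ⟨f, hf⟩ := hne
  refine ⟨x, fun v hv => ?_, recessionCone_face hP ⟨f, hf⟩⟩
  have := hm _ (add_smul_mem_of_mem_recessionCone hf.1 hv zero_le_one)
  rw [map_add, hf.2, one_smul] at this
  linarith

/-- Every face of the recession cone of a polyhedron is the recession cone of a face. -/
theorem exists_face_recessionCone_eq {P G : Set V} (hP : IsPolyhedron P) (hne : P.Nonempty)
    (hG : IsFace G (recessionCone P)) : ∃ F, IsFace F P ∧ recessionCone F = G := by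
  classical
  obtain ⟨H, rfl⟩ := hP
  have hrec := recessionCone_solutionSet hne
  obtain ⟨x, hx, rfl⟩ := (isConic_recessionCone _).isFace_iff.1 hG
  rw [hrec] at hx ⊢
  -- `c` is generic in the given face of the recession cone, so the constraints in `J` below are
  -- those vanishing on that whole face.
  obtain ⟨c, ⟨hcP, hcx⟩, hcH⟩ := exists_generic_mem
    (C := {u | u ∈ {u | ∀ h ∈ H, 0 ≤ h.1 u} ∧ x u = 0}) ⟨by simp, by simp⟩
    (fun u hu v hv => ⟨fun h hh => by
      rw [map_add]; exact add_nonneg (hu.1 h hh) (hv.1 h hh), by simp [hu.2, hv.2]⟩)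
    H (fun u hu => hu.1)
  set J := H.filter fun h => h.1 c = 0 with hJ
  -- a point of `P` whose set of tight constraints in `J` is maximal
  let T : V → Finset (Module.Dual ℝ V × ℝ) := fun p => J.filter fun h => h.1 p = h.2
  have hfin : (T '' solutionSet H).Finite :=
    Set.Finite.subset J.powerset.finite_toSet (by
      rintro _ ⟨p, -, rfl⟩
      exact Finset.mem_coe.2 (Finset.mem_powerset.2 (Finset.filter_subset _ _)))
  obtain ⟨_, ⟨⟨p, hp, rfl⟩, hmax⟩⟩ := hfin.exists_maximal (hne.image T)
  have htight : ∀ u, (∀ h ∈ H, 0 ≤ h.1 u) → (∀ h ∈ T p, h.1 u = 0) → ∀ h ∈ J, h.1 u = 0 := by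
    intro u hu huT
    by_contra! hcon
    obtain ⟨j, hjJ, hj⟩ := hcon
    have hK : (J.filter fun h => h.1 u ≠ 0).Nonempty := ⟨j, Finset.mem_filter.2 ⟨hjJ, hj⟩⟩
    -- `k` is the first constraint of `J` to become tight as `p` moves in direction `-u`.
    obtain ⟨k, hk, hkmin⟩ := Finset.exists_min_image _ (fun h => (h.1 p - h.2) / h.1 u) hK
    rw [Finset.mem_filter, hJ, Finset.mem_filter] at hk
    obtain ⟨⟨hkH, hkc⟩, hku⟩ := hk
    have hku' : 0 < k.1 u := lt_of_le_of_ne (hu k hkH) (Ne.symm hku)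
    set s := (k.1 p - k.2) / k.1 u with hs
    have hs0 : 0 ≤ s := div_nonneg (sub_nonneg.2 (hp k hkH)) hku'.le
    -- The move may violate constraints outside `J`. These are positive on `c`, so a large multiple
    -- of `c` repairs them without changing any constraint in `J`.
    obtain ⟨r, hr⟩ := (eventually_add_smul_mem_solutionSet (H := H) (q := p - s • u) (w := c)
      hcP (fun h hh h0 => by
        rw [map_sub, map_smul, smul_eq_mul]
        by_cases hhu : h.1 u = 0
        · simpa [hhu] using hp h hh
        · have := hkmin h (Finset.mem_filter.2 ⟨Finset.mem_filter.2 ⟨hh, h0⟩, hhu⟩)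
          rw [le_div_iff₀ (lt_of_le_of_ne (hu h hh) (Ne.symm hhu))] at this
          linarith)).exists
    have hsub : T p ⊆ T (p - s • u + r • c) := by
      intro h hh
      have h0 := huT h hh
      rw [Finset.mem_filter] at hh ⊢
      refine ⟨hh.1, ?_⟩
      simp [h0, (Finset.mem_filter.1 hh.1).2, hh.2]
    have hkT : k ∈ T (p - s • u + r • c) := by
      refine Finset.mem_filter.2 ⟨Finset.mem_filter.2 ⟨hkH, hkc⟩, ?_⟩
      have : s * k.1 u = k.1 p - k.2 := div_mul_cancel₀ _ hku
      simp [hkc, this]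
    exact hku (huT k (hmax ⟨_, hr, rfl⟩ hsub hkT))
  have hTH : ∀ h ∈ T p, h ∈ H ∧ h.1 c = 0 ∧ h.1 p = h.2 := by
    intro h hh
    simp only [T, hJ, Finset.mem_filter] at hh
    tauto
  have hpF : p ∈ {q | q ∈ solutionSet H ∧ (∑ h ∈ T p, h.1) q = ∑ h ∈ T p, h.2} := by
    refine ⟨hp, ?_⟩
    rw [LinearMap.sum_apply]
    exact Finset.sum_congr rfl fun h hh => (hTH h hh).2.2
  refine ⟨_, isFace_iff.2 ⟨⟨p, hpF⟩, _, _, fun v hv => ?_, rfl⟩, ?_⟩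
  · rw [LinearMap.sum_apply]
    exact Finset.sum_le_sum fun h hh => hv h (hTH h hh).1
  · rw [recessionCone_face ⟨H, rfl⟩ ⟨p, hpF⟩, hrec]
    ext u
    rw [Set.mem_ofPred_eq, Set.mem_ofPred_eq]
    refine and_congr_right fun hu => ?_
    rw [LinearMap.sum_apply, Finset.sum_eq_zero_iff_of_nonneg fun h hh => hu h (hTH h hh).1]
    constructor
    · intro huT
      obtain ⟨r, hr, h⟩ := exists_smul_sub_nonneg (H := H) (c := c) (v := u) hcP
        (fun h hh h0 => htight u hu huT h (Finset.mem_filter.2 ⟨hh, h0⟩))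
      have h1 := hx (r • c - u) h
      rw [map_sub, map_smul, hcx, smul_zero] at h1
      linarith [hx u hu]
    · intro hxu h hh
      exact hcH h (hTH h hh).1 (hTH h hh).2.1 u ⟨hu, hxu⟩

end Algebra
end PolyComplex

namespace PolyComplex

open Filter Topology

/-! ### Cones over polyhedra and their faces -/

section Cones

variable {V : Type*} [NormedAddCommGroup V] [NormedSpace ℝ V]

/-- The inequalities of the cone over the solution set of `H`. -/
noncomputable def coneSystem {V : Type*} [AddCommGroup V] [Module ℝ V]
    (H : Finset (Module.Dual ℝ V × ℝ)) : Finset (Module.Dual ℝ (V × ℝ) × ℝ) :=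
  open Classical in insert (LinearMap.snd ℝ V ℝ, 0)
    (H.image fun h => (h.1 ∘ₗ LinearMap.fst ℝ V ℝ - h.2 • LinearMap.snd ℝ V ℝ, 0))

/-- The inequalities of the recession cone of the solution set of `H`, placed at height `0`. -/
noncomputable def recessionSystem {V : Type*} [AddCommGroup V] [Module ℝ V]
    (H : Finset (Module.Dual ℝ V × ℝ)) : Finset (Module.Dual ℝ (V × ℝ) × ℝ) :=
  open Classical in insert (-LinearMap.snd ℝ V ℝ, 0) (coneSystem H)

theorem mem_solutionSet_coneSystem {V : Type*} [AddCommGroup V] [Module ℝ V]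
    {H : Finset (Module.Dual ℝ V × ℝ)} {z : V × ℝ} :
    z ∈ solutionSet (coneSystem H) ↔ 0 ≤ z.2 ∧ ∀ h ∈ H, h.2 * z.2 ≤ h.1 z.1 := by
  classical
  simp only [solutionSet, coneSystem, Set.mem_ofPred_eq, Finset.forall_mem_insert,
    Finset.forall_mem_image]
  simp

theorem mem_solutionSet_recessionSystem {V : Type*} [AddCommGroup V] [Module ℝ V]
    {H : Finset (Module.Dual ℝ V × ℝ)} {z : V × ℝ} :
    z ∈ solutionSet (recessionSystem H) ↔ z.2 = 0 ∧ ∀ h ∈ H, 0 ≤ h.1 z.1 := by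
  classical
  have : z ∈ solutionSet (recessionSystem H) ↔
      0 ≤ -z.2 ∧ z ∈ solutionSet (coneSystem H) := by
    simp [solutionSet, recessionSystem]
  rw [this, mem_solutionSet_coneSystem]
  constructor
  · rintro ⟨h1, h2, h3⟩
    have h0 : z.2 = 0 := by linarith
    exact ⟨h0, by simpa [h0] using h3⟩
  · rintro ⟨h0, h3⟩
    simpa [h0] using h3

theorem prod_zero_eq_solutionSet {V : Type*} [AddCommGroup V] [Module ℝ V]
    {H : Finset (Module.Dual ℝ V × ℝ)} (hne : (solutionSet H).Nonempty) :
    recessionCone (solutionSet H) ×ˢ ({0} : Set ℝ) = solutionSet (recessionSystem H) := by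
  ext z
  rw [mem_solutionSet_recessionSystem, recessionCone_solutionSet hne, Set.mem_prod, and_comm]
  rfl

theorem isClosed_solutionSet [FiniteDimensional ℝ V] (H : Finset (Module.Dual ℝ V × ℝ)) :
    IsClosed (solutionSet H) := by
  have : solutionSet H = ⋂ h ∈ H, {u | h.2 ≤ h.1 u} := by
    ext; simp [solutionSet]
  rw [this]
  exact isClosed_biInter fun h _ =>
    isClosed_le continuous_const h.1.continuous_of_finiteDimensional

theorem coneOver_solutionSet [FiniteDimensional ℝ V] {H : Finset (Module.Dual ℝ V × ℝ)}
    (hne : (solutionSet H).Nonempty) :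
    coneOver (solutionSet H) = solutionSet (coneSystem H) := by
  apply Set.Subset.antisymm
  · refine closure_minimal ?_ (isClosed_solutionSet _)
    rintro _ ⟨r, hr, u, hu, rfl⟩
    rw [mem_solutionSet_coneSystem]
    refine ⟨by simpa using hr.le, fun h hh => ?_⟩
    simp only [Prod.smul_mk, smul_eq_mul, mul_one, map_smul]
    rw [mul_comm]
    exact mul_le_mul_of_nonneg_left (hu h hh) hr.le
  · obtain ⟨p, hp⟩ := hne
    rintro ⟨u, t⟩ hz
    rw [mem_solutionSet_coneSystem] at hz
    obtain ⟨ht, hz⟩ := hz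
    -- Adding `ε • (p, 1)` with `p` in the polyhedron pushes a solution, possibly at height zero, to
    -- positive height.
    have hmem : ∀ᶠ ε : ℝ in 𝓝[>] 0, (u + ε • p, t + ε) ∈
        {z : V × ℝ | ∃ r : ℝ, 0 < r ∧ ∃ u ∈ solutionSet H, z = r • (u, (1 : ℝ))} := by
      filter_upwards [self_mem_nhdsWithin] with ε hε
      have hε : 0 < ε := hε
      have hs : 0 < t + ε := add_pos_of_nonneg_of_pos ht hε
      refine ⟨t + ε, hs, (t + ε)⁻¹ • (u + ε • p), fun h hh => ?_, ?_⟩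
      · rw [map_smul, smul_eq_mul, le_inv_mul_iff₀ hs, map_add, map_smul, smul_eq_mul]
        nlinarith [hz h hh, hp h hh]
      · rw [Prod.smul_mk, smul_smul, mul_inv_cancel₀ hs.ne', one_smul, smul_eq_mul, mul_one]
    refine mem_closure_of_tendsto (f := fun ε : ℝ => (u + ε • p, t + ε)) ?_ hmem
    have : Continuous fun ε : ℝ => (u + ε • p, t + ε) := by fun_prop
    simpa using (this.tendsto 0).mono_left nhdsWithin_le_nhds

theorem isPolyhedron_coneOver [FiniteDimensional ℝ V] {P : Set V} (hP : IsPolyhedron P)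
    (hne : P.Nonempty) : IsPolyhedron (coneOver P) := by
  obtain ⟨H, rfl⟩ := hP
  exact ⟨_, coneOver_solutionSet hne⟩

theorem isPolyhedron_recessionCone_prod_zero {P : Set V} (hP : IsPolyhedron P)
    (hne : P.Nonempty) : IsPolyhedron (recessionCone P ×ˢ ({0} : Set ℝ)) := by
  obtain ⟨H, rfl⟩ := hP
  exact ⟨_, prod_zero_eq_solutionSet hne⟩

theorem mem_coneOver [FiniteDimensional ℝ V] {P : Set V} (hP : IsPolyhedron P)
    (hne : P.Nonempty) {z : V × ℝ} :
    z ∈ coneOver P ↔ (0 < z.2 ∧ z.2⁻¹ • z.1 ∈ P) ∨ (z.2 = 0 ∧ z.1 ∈ recessionCone P) := by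
  obtain ⟨H, rfl⟩ := hP
  rw [coneOver_solutionSet hne, mem_solutionSet_coneSystem, recessionCone_solutionSet hne,
    le_iff_lt_or_eq, or_and_right]
  refine or_congr (and_congr_right fun h0 => forall₂_congr fun h hh => ?_) ?_
  · rw [map_smul, smul_eq_mul, le_inv_mul_iff₀ h0, mul_comm]
  · rw [eq_comm]
    refine and_congr_right fun h0 => ?_
    simp [h0]

theorem mk_one_mem_coneOver [FiniteDimensional ℝ V] {P : Set V} (hP : IsPolyhedron P)
    (hne : P.Nonempty) {u : V} : (u, (1 : ℝ)) ∈ coneOver P ↔ u ∈ P := by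
  simp [mem_coneOver hP hne]

theorem mk_zero_mem_coneOver [FiniteDimensional ℝ V] {P : Set V} (hP : IsPolyhedron P)
    (hne : P.Nonempty) {u : V} : (u, (0 : ℝ)) ∈ coneOver P ↔ u ∈ recessionCone P := by
  simp [mem_coneOver hP hne]

theorem snd_nonneg_of_mem_coneOver [FiniteDimensional ℝ V] {P : Set V} (hP : IsPolyhedron P)
    (hne : P.Nonempty) {z : V × ℝ} (hz : z ∈ coneOver P) : 0 ≤ z.2 := by
  rcases (mem_coneOver hP hne).1 hz with h | h
  exacts [h.1.le, h.1.ge]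

theorem isConic_coneOver [FiniteDimensional ℝ V] {P : Set V} (hP : IsPolyhedron P)
    (hne : P.Nonempty) : IsConic (coneOver P) := by
  obtain ⟨H, rfl⟩ := hP
  rw [coneOver_solutionSet hne]
  refine ⟨⟨0, mem_solutionSet_coneSystem.2 (by simp)⟩, fun r hr z hz => ?_⟩
  rw [mem_solutionSet_coneSystem] at hz ⊢
  refine ⟨mul_nonneg hr hz.1, fun h hh => ?_⟩
  simp only [Prod.smul_fst, Prod.smul_snd, map_smul, smul_eq_mul]
  nlinarith [mul_le_mul_of_nonneg_left (hz.2 h hh) hr]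

theorem isConic_prod_zero {V : Type*} [AddCommGroup V] [Module ℝ V] {P : Set V}
    (hP : IsConic P) : IsConic (P ×ˢ ({0} : Set ℝ)) := by
  refine ⟨hP.1.prod (Set.singleton_nonempty 0), ?_⟩
  rintro r hr ⟨u, t⟩ ⟨hu, ht⟩
  rw [Set.mem_singleton_iff] at ht
  exact ⟨hP.2 r hr u hu, by simpa using Or.inr ht⟩

theorem coneOver_inter [FiniteDimensional ℝ V] {P Q : Set V} (hP : IsPolyhedron P)
    (hQ : IsPolyhedron Q) (hPQ : IsPolyhedron (P ∩ Q)) (hne : (P ∩ Q).Nonempty) :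
    coneOver P ∩ coneOver Q = coneOver (P ∩ Q) := by
  ext z
  rw [Set.mem_inter_iff, mem_coneOver hP hne.left, mem_coneOver hQ hne.right,
    mem_coneOver hPQ hne, recessionCone_inter hP hQ hne, Set.mem_inter_iff, Set.mem_inter_iff]
  constructor
  · rintro ⟨h1 | h1, h2 | h2⟩
    · tauto
    · exact absurd h2.1 h1.1.ne'
    · exact absurd h1.1 h2.1.ne'
    · tauto
  · tauto

theorem coneOver_inter_of_disjoint [FiniteDimensional ℝ V] {P Q : Set V} (hP : IsPolyhedron P)
    (hQ : IsPolyhedron Q) (hP' : P.Nonempty) (hQ' : Q.Nonempty) (hd : Disjoint P Q) :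
    coneOver P ∩ coneOver Q = (recessionCone P ∩ recessionCone Q) ×ˢ ({0} : Set ℝ) := by
  ext z
  rw [Set.mem_inter_iff, mem_coneOver hP hP', mem_coneOver hQ hQ', Set.mem_prod,
    Set.mem_singleton_iff, Set.mem_inter_iff]
  constructor
  · rintro ⟨h1 | h1, h2 | h2⟩
    · exact absurd h2.2 (Set.disjoint_left.1 hd h1.2)
    · exact absurd h2.1 h1.1.ne'
    · exact absurd h1.1 h2.1.ne'
    · tauto
  · tauto

theorem coneOver_inter_prod_zero [FiniteDimensional ℝ V] {P Q : Set V} (hP : IsPolyhedron P)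
    (hP' : P.Nonempty) :
    coneOver P ∩ (Q ×ˢ ({0} : Set ℝ)) = (recessionCone P ∩ Q) ×ˢ ({0} : Set ℝ) := by
  ext ⟨u, t⟩
  simp only [Set.mem_inter_iff, Set.mem_prod, Set.mem_singleton_iff]
  constructor
  · rintro ⟨h1, h2, rfl⟩
    exact ⟨⟨(mk_zero_mem_coneOver hP hP').1 h1, h2⟩, rfl⟩
  · rintro ⟨⟨h1, h2⟩, rfl⟩
    exact ⟨(mk_zero_mem_coneOver hP hP').2 h1, h2, rfl⟩

/-! ### Faces of cones over polyhedra -/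

theorem isFace_prod_zero {V : Type*} [AddCommGroup V] [Module ℝ V] {P F : Set V}
    (hP : IsConic P) (hF : IsFace F P) : IsFace (F ×ˢ ({0} : Set ℝ)) (P ×ˢ ({0} : Set ℝ)) := by
  obtain ⟨x, hx, rfl⟩ := hP.isFace_iff.1 hF
  refine (isConic_prod_zero hP).isFace_iff.2 ⟨x ∘ₗ LinearMap.fst ℝ V ℝ, fun v hv => hx _ hv.1, ?_⟩
  ext ⟨u, t⟩
  simp only [Set.mem_prod, Set.mem_ofPred_eq, LinearMap.comp_apply, LinearMap.fst_apply]
  tauto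

theorem exists_of_isFace_prod_zero {V : Type*} [AddCommGroup V] [Module ℝ V] {P : Set V}
    {G : Set (V × ℝ)} (hP : IsConic P) (hG : IsFace G (P ×ˢ ({0} : Set ℝ))) :
    ∃ F, IsFace F P ∧ G = F ×ˢ ({0} : Set ℝ) := by
  obtain ⟨x, hx, rfl⟩ := (isConic_prod_zero hP).isFace_iff.1 hG
  refine ⟨_, hP.isFace_iff.2 ⟨x ∘ₗ LinearMap.inl ℝ V ℝ, fun v hv => hx _ ⟨hv, rfl⟩, rfl⟩, ?_⟩
  ext ⟨u, t⟩
  simp only [Set.mem_prod, Set.mem_ofPred_eq, LinearMap.comp_apply, LinearMap.inl_apply,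
    Set.mem_singleton_iff]
  constructor
  · rintro ⟨⟨h1, rfl⟩, h2⟩
    exact ⟨⟨h1, h2⟩, rfl⟩
  · rintro ⟨⟨h1, h2⟩, rfl⟩
    exact ⟨⟨h1, rfl⟩, h2⟩

theorem isFace_coneOver [FiniteDimensional ℝ V] {P F : Set V} (hP : IsPolyhedron P)
    (hF : IsFace F P) : IsFace (coneOver F) (coneOver P) := by
  have hFP := hF.isPolyhedron hP
  obtain ⟨hne, x, m, hm, rfl⟩ := isFace_iff.1 hF
  have hneP : P.Nonempty := hne.mono hF.subset
  have hxrec : ∀ v ∈ recessionCone P, 0 ≤ x v := by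
    obtain ⟨f, hf⟩ := hne
    intro v hv
    have := hm _ (add_smul_mem_of_mem_recessionCone hf.1 hv zero_le_one)
    rw [map_add, hf.2, one_smul] at this
    linarith
  refine (isConic_coneOver hP hneP).isFace_iff.2
    ⟨x ∘ₗ LinearMap.fst ℝ V ℝ - m • LinearMap.snd ℝ V ℝ, fun v hv => ?_, ?_⟩
  · simp only [LinearMap.sub_apply, LinearMap.comp_apply, LinearMap.fst_apply,
      LinearMap.smul_apply, LinearMap.snd_apply, smul_eq_mul, sub_nonneg]
    rcases (mem_coneOver hP hneP).1 hv with ⟨h1, h2⟩ | ⟨h1, h2⟩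
    · have := hm _ h2
      rwa [map_smul, smul_eq_mul, le_inv_mul_iff₀ h1, mul_comm] at this
    · rw [h1, mul_zero]
      exact hxrec _ h2
  · ext z
    rw [Set.mem_ofPred_eq, mem_coneOver hFP hne, mem_coneOver hP hneP, recessionCone_face hP hne,
      or_and_right]
    simp only [LinearMap.sub_apply, LinearMap.comp_apply, LinearMap.fst_apply,
      LinearMap.smul_apply, LinearMap.snd_apply, smul_eq_mul, Set.mem_ofPred_eq, map_smul]
    refine or_congr ?_ ?_
    · rw [and_assoc]
      refine and_congr_right fun h0 => and_congr_right fun _ => ?_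
      rw [inv_mul_eq_iff_eq_mul₀ h0.ne', sub_eq_zero, mul_comm]
    · rw [and_assoc]
      refine and_congr_right fun h0 => and_congr_right fun _ => ?_
      rw [h0, mul_zero, sub_zero]

theorem isFace_prod_zero_coneOver [FiniteDimensional ℝ V] {P F : Set V} (hP : IsPolyhedron P)
    (hF : IsFace F P) : IsFace (recessionCone F ×ˢ ({0} : Set ℝ)) (coneOver P) := by
  have hFP := hF.isPolyhedron hP
  have hneP : P.Nonempty := hF.1.mono hF.subset
  obtain ⟨y, hy, hyF⟩ := (isConic_coneOver hP hneP).isFace_iff.1 (isFace_coneOver hP hF)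
  have h2 : ∀ v ∈ coneOver P, 0 ≤ v.2 := fun v hv => snd_nonneg_of_mem_coneOver hP hneP hv
  refine (isConic_coneOver hP hneP).isFace_iff.2
    -- The height is non-negative on the cone; adding it to the functional of `coneOver F` cuts that
    -- face down to height zero.
    ⟨y + LinearMap.snd ℝ V ℝ, fun v hv => add_nonneg (hy v hv) (h2 v hv), ?_⟩
  ext ⟨u, t⟩
  simp only [Set.mem_prod, Set.mem_singleton_iff, Set.mem_ofPred_eq, LinearMap.add_apply,
    LinearMap.snd_apply]
  constructor
  · rintro ⟨hu, rfl⟩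
    have := (mk_zero_mem_coneOver hFP hF.1).2 hu
    rw [hyF] at this
    exact ⟨this.1, by simpa using this.2⟩
  · rintro ⟨hu, h0⟩
    have ha := hy _ hu
    have hb := h2 _ hu
    obtain rfl : t = 0 := by linarith
    refine ⟨(mk_zero_mem_coneOver hFP hF.1).1 ?_, rfl⟩
    rw [hyF]
    exact ⟨hu, by linarith⟩

/-- The faces of the cone over `P` are the cones over the faces of `P`, and the recession cones
of the faces of `P`. -/
theorem exists_of_isFace_coneOver [FiniteDimensional ℝ V] {P : Set V} {G : Set (V × ℝ)}
    (hP : IsPolyhedron P) (hne : P.Nonempty) (hG : IsFace G (coneOver P)) :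
    ∃ F, IsFace F P ∧ (G = coneOver F ∨ G = recessionCone F ×ˢ ({0} : Set ℝ)) := by
  obtain ⟨y, hy, rfl⟩ := (isConic_coneOver hP hne).isFace_iff.1 hG
  have hsplit : ∀ u t, y (u, t) = y (u, 0) + t * y (0, 1) := by
    intro u t
    rw [← smul_eq_mul, ← map_smul, ← map_add]
    simp
  -- If the face reaches height one, `y` restricted to `P` has minimum `-y (0, 1)` and this gives
  -- `F`. Otherwise the face lies at height zero, and it is a face of the recession cone.
  by_cases hpos : ∃ u ∈ P, y (u, 1) = 0
  · have hne' : {u | u ∈ P ∧ (y ∘ₗ LinearMap.inl ℝ V ℝ) u = -y (0, 1)}.Nonempty := by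
      obtain ⟨u, hu, h0⟩ := hpos
      refine ⟨u, hu, ?_⟩
      rw [hsplit] at h0
      simp only [LinearMap.comp_apply, LinearMap.inl_apply]
      linarith
    have hF : IsFace {u | u ∈ P ∧ (y ∘ₗ LinearMap.inl ℝ V ℝ) u = -y (0, 1)} P := by
      refine isFace_iff.2 ⟨hne', _, _, fun v hv => ?_, rfl⟩
      have := hy _ ((mk_one_mem_coneOver hP hne).2 hv)
      rw [hsplit] at this
      simp only [LinearMap.comp_apply, LinearMap.inl_apply]
      linarith
    refine ⟨_, hF, Or.inl ?_⟩
    ext ⟨u, t⟩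
    rw [Set.mem_ofPred_eq, mem_coneOver (hF.isPolyhedron hP) hne', mem_coneOver hP hne,
      recessionCone_face hP hne', or_and_right]
    simp only [Set.mem_ofPred_eq, LinearMap.comp_apply, LinearMap.inl_apply]
    refine or_congr ?_ ?_
    · rw [and_assoc]
      refine and_congr_right fun h0 => and_congr_right fun _ => ?_
      have : y (t⁻¹ • u, 0) = t⁻¹ * y (u, 0) := by
        rw [← smul_eq_mul, ← map_smul]; simp
      rw [this, inv_mul_eq_iff_eq_mul₀ h0.ne', hsplit]
      constructor <;> intro h <;> linarith
    · rw [and_assoc]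
      refine and_congr_right fun h0 => and_congr_right fun _ => ?_
      rw [h0]
  · push Not at hpos
    have hrec : IsFace {u | u ∈ recessionCone P ∧ (y ∘ₗ LinearMap.inl ℝ V ℝ) u = 0}
        (recessionCone P) :=
      (isConic_recessionCone P).isFace_iff.2
        ⟨_, fun v hv => hy _ ((mk_zero_mem_coneOver hP hne).2 hv), rfl⟩
    obtain ⟨F, hF, hFG⟩ := exists_face_recessionCone_eq hP hne hrec
    refine ⟨F, hF, Or.inr ?_⟩
    rw [hFG]
    ext ⟨u, t⟩
    simp only [Set.mem_ofPred_eq, Set.mem_prod, Set.mem_singleton_iff, LinearMap.comp_apply,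
      LinearMap.inl_apply]
    constructor
    · rintro ⟨hu, h0⟩
      rcases (mem_coneOver hP hne).1 hu with ⟨h1, h2⟩ | ⟨h1, h2⟩
      · refine absurd ?_ (hpos _ h2)
        have : ((t⁻¹ • u, 1) : V × ℝ) = t⁻¹ • (u, t) := by
          simp [inv_mul_cancel₀ (show t ≠ 0 from h1.ne')]
        rw [this, map_smul, h0, smul_zero]
      · have h1 : t = 0 := h1
        subst h1
        exact ⟨⟨h2, h0⟩, rfl⟩
    · rintro ⟨⟨h1, h2⟩, rfl⟩
      exact ⟨(mk_zero_mem_coneOver hP hne).2 h1, h2⟩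

/-! ### Slices at height one -/

/-- The inequalities of the slice at height `1` of the solution set of `H`. -/
noncomputable def sliceSystem {V : Type*} [AddCommGroup V] [Module ℝ V]
    (H : Finset (Module.Dual ℝ (V × ℝ) × ℝ)) : Finset (Module.Dual ℝ V × ℝ) :=
  open Classical in H.image fun h => (h.1 ∘ₗ LinearMap.inl ℝ V ℝ, h.2 - h.1 (0, 1))

theorem slice_solutionSet {V : Type*} [AddCommGroup V] [Module ℝ V]
    (H : Finset (Module.Dual ℝ (V × ℝ) × ℝ)) :
    {u | (u, (1 : ℝ)) ∈ solutionSet H} = solutionSet (sliceSystem H) := by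
  classical
  ext u
  simp only [solutionSet, sliceSystem, Set.mem_ofPred_eq, Finset.forall_mem_image,
    LinearMap.comp_apply, LinearMap.inl_apply]
  refine forall₂_congr fun h _ => ?_
  rw [sub_le_iff_le_add, ← map_add]
  simp

theorem isPolyhedron_slice {V : Type*} [AddCommGroup V] [Module ℝ V] {s : Set (V × ℝ)}
    (hs : IsPolyhedron s) : IsPolyhedron {u | (u, (1 : ℝ)) ∈ s} := by
  obtain ⟨H, rfl⟩ := hs
  exact ⟨_, slice_solutionSet H⟩

/-- A polyhedral cone in the upper halfspace is the cone over its slice at height `1`, if that is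
non-empty. -/
theorem coneOver_slice [FiniteDimensional ℝ V] {s : Set (V × ℝ)} (hs : IsPolyhedron s)
    (hc : IsConic s) (hpos : ∀ z ∈ s, 0 ≤ z.2) (hne : {u | (u, (1 : ℝ)) ∈ s}.Nonempty) :
    coneOver {u | (u, (1 : ℝ)) ∈ s} = s := by
  have hP := isPolyhedron_slice hs
  have hscale : ∀ (u : V) (t : ℝ), 0 < t → ((t⁻¹ • u, (1 : ℝ)) ∈ s ↔ (u, t) ∈ s) := by
    intro u t ht
    constructor
    · intro h
      simpa [smul_smul, mul_inv_cancel₀ ht.ne'] using hc.2 t ht.le _ h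
    · intro h
      simpa [inv_mul_cancel₀ ht.ne'] using hc.2 t⁻¹ (inv_nonneg.2 ht.le) _ h
  ext ⟨u, t⟩
  rw [mem_coneOver hP hne]
  have hrec : u ∈ recessionCone {u | (u, (1 : ℝ)) ∈ s} ↔ (u, (0 : ℝ)) ∈ s := by
    obtain ⟨p, hp⟩ := hne
    rw [mem_recessionCone_iff_of_mem hP hp]
    have heq : ∀ r : ℝ, ((p + r • u, 1) : V × ℝ) = (p, 1) + r • (u, (0 : ℝ)) := by
      intro r; simp
    constructor
    · intro h
      have hs0 : (u, (0 : ℝ)) ∈ recessionCone s := by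
        refine (mem_recessionCone_iff_of_mem hs hp _).2 fun r hr => ?_
        rw [← heq]
        exact h r hr
      simpa using add_smul_mem_of_mem_recessionCone hc.zero_mem hs0 zero_le_one
    · intro h r hr
      rw [Set.mem_ofPred_eq, heq]
      exact hc.add_mem hs hp (hc.2 r hr _ h)
  rw [Set.mem_ofPred_eq, hrec]
  constructor
  · rintro (⟨h1, h2⟩ | ⟨h1, h2⟩)
    · exact (hscale _ _ h1).1 h2
    · have h1 : t = 0 := h1
      rwa [h1]
  · intro h
    rcases (hpos _ h).lt_or_eq with h0 | h0
    · exact Or.inl ⟨h0, (hscale _ _ h0).2 h⟩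
    · have h0 : 0 = t := h0
      subst h0
      exact Or.inr ⟨rfl, h⟩

end Cones

end PolyComplex

namespace PolyComplex

open Filter Topology

/-! ### Complete complexes and the two maps -/

section Complexes

variable {V : Type*} [NormedAddCommGroup V] [NormedSpace ℝ V]

theorem exists_mem_of_complete {V : Type*} [AddCommGroup V] [Module ℝ V] {C : Set (Set V)}
    (hC : C ∈ completeComplexes V) (u : V) : ∃ P ∈ C, u ∈ P := by
  have : u ∈ support C := by rw [hC.2]; trivial
  simpa [support] using this

/-- Far along `w` the constraints positive on `w` hold automatically, so the tube is cut out by the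
constraints that vanish on `w`. -/
theorem isClosed_recessionTube [FiniteDimensional ℝ V] {P : Set V} (hP : IsPolyhedron P)
    {w : V} (hw : w ∈ recessionCone P) : IsClosed {q | ∃ r : ℝ, q + r • w ∈ P} := by
  obtain ⟨H, rfl⟩ := hP
  by_cases hne : (solutionSet H).Nonempty
  · have hw' := hw
    rw [recessionCone_solutionSet hne] at hw'
    have : {q | ∃ r : ℝ, q + r • w ∈ solutionSet H} =
        ⋂ h ∈ H, ⋂ (_ : h.1 w = 0), {q | h.2 ≤ h.1 q} := by
      ext q
      simp only [Set.mem_ofPred_eq, Set.mem_iInter]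
      constructor
      · rintro ⟨r, hr⟩ h hh h0
        simpa [h0] using hr h hh
      · intro hq
        exact (eventually_add_smul_mem_solutionSet hw' hq).exists
    rw [this]
    exact isClosed_biInter fun h _ => isClosed_iInter fun _ =>
      isClosed_le continuous_const h.1.continuous_of_finiteDimensional
  · rw [Set.not_nonempty_iff_eq_empty] at hne
    simp [hne]

/-- In a complete complex, two cells whose recession cones share the sum of two recession
directions `a`, `b` of the first one have both directions in common. -/
theorem mem_recessionCone_of_add_mem [FiniteDimensional ℝ V] {C : Set (Set V)}
    (hC : C ∈ completeComplexes V) {P Q : Set V} (hP : P ∈ C) (hQ : Q ∈ C) {a b : V}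
    (ha : a ∈ recessionCone P) (hb : b ∈ recessionCone P) (hab : a + b ∈ recessionCone Q) :
    a ∈ recessionCone Q ∧ b ∈ recessionCone Q := by
  have hcx := hC.1
  have habP : a + b ∈ recessionCone P :=
    (isConic_recessionCone P).add_mem
      (isPolyhedron_recessionCone (hcx.isPolyhedron P hP) (hcx.nonempty_of_mem P hP)) ha hb
  by_contra hcon
  let D : Set (Set V) := {R ∈ C | a + b ∈ recessionCone R}
  let A : Set (Set V) := {R ∈ D | a ∈ recessionCone R ∧ b ∈ recessionCone R}
  let B : Set (Set V) := {R ∈ D | ¬ (a ∈ recessionCone R ∧ b ∈ recessionCone R)}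
  let E : Set V → Set V := fun R => {q | ∃ r : ℝ, q + r • (a + b) ∈ R}
  have hclosed : ∀ S ⊆ D, IsClosed (⋃ R ∈ S, E R) := fun S hS =>
    (hcx.finite.subset (hS.trans fun R hR => hR.1)).isClosed_biUnion fun R hR =>
      isClosed_recessionTube (hcx.isPolyhedron R (hS hR).1) (hS hR).2
  have hne : ∀ R ∈ C, ∃ q, q ∈ E R := fun R hR => by
    obtain ⟨q, hq⟩ := hcx.nonempty_of_mem R hR
    exact ⟨q, 0, by simpa using hq⟩
  -- Finitely many cells cover the ray from `q` in direction `a + b`, so one of them contains points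
  -- of it arbitrarily far out.
  have hcover : ∀ q : V, ∃ R ∈ D, q ∈ E R := by
    intro q
    by_contra! hq
    have hall : ∀ᶠ r : ℝ in atTop, ∀ R ∈ C, q + r • (a + b) ∉ R := by
      rw [Filter.eventually_all_finite hcx.finite]
      intro R hR
      by_contra hf
      have hf : ∃ᶠ r : ℝ in atTop, q + r • (a + b) ∈ R := by simpa [Filter.Frequently] using hf
      exact hq R ⟨hR, mem_recessionCone_of_frequently (hcx.isPolyhedron R hR) hf⟩ hf.exists
    obtain ⟨r, hr⟩ := hall.exists
    obtain ⟨R, hR, h⟩ := exists_mem_of_complete hC (q + r • (a + b))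
    exact hr R hR h
  have hunion : Set.univ ⊆ (⋃ R ∈ A, E R) ∪ ⋃ R ∈ B, E R := by
    intro q _
    obtain ⟨R, hR, h⟩ := hcover q
    by_cases hRA : a ∈ recessionCone R ∧ b ∈ recessionCone R
    · exact Or.inl (Set.mem_biUnion (show R ∈ A from ⟨hR, hRA⟩) h)
    · exact Or.inr (Set.mem_biUnion (show R ∈ B from ⟨hR, hRA⟩) h)
  obtain ⟨p, hp⟩ := hne P hP
  obtain ⟨p', hp'⟩ := hne Q hQ
  obtain ⟨q, -, hqA, hqB⟩ := isPreconnected_closed_iff.1 (isPreconnected_univ (α := V))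
    _ _ (hclosed A fun R hR => hR.1) (hclosed B fun R hR => hR.1) hunion
    ⟨p, trivial, Set.mem_biUnion (show P ∈ A from ⟨⟨hP, habP⟩, ha, hb⟩) hp⟩
    ⟨p', trivial, Set.mem_biUnion (show Q ∈ B from ⟨⟨hQ, hab⟩, hcon⟩) hp'⟩
  simp only [Set.mem_iUnion, exists_prop] at hqA hqB
  obtain ⟨R, ⟨⟨hR, hRab⟩, hRa, hRb⟩, r, hr⟩ := hqA
  obtain ⟨T, ⟨⟨hT, hTab⟩, hTcon⟩, t, ht⟩ := hqB
  have hRp := hcx.isPolyhedron R hR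
  have hTp := hcx.isPolyhedron T hT
  -- Each tube membership gives a point on the same line; both cells contain all later points of it.
  have hRT : q + max r t • (a + b) ∈ R ∩ T := by
    constructor
    · have := add_smul_mem_of_mem_recessionCone hr hRab (sub_nonneg.2 (le_max_left r t))
      rwa [add_assoc, ← add_smul, add_sub_cancel] at this
    · have := add_smul_mem_of_mem_recessionCone ht hTab (sub_nonneg.2 (le_max_right r t))
      rwa [add_assoc, ← add_smul, add_sub_cancel] at this
  rcases hcx.inter R hR T hT with hd | ⟨hF, -⟩
  · exact Set.disjoint_left.1 hd hRT.1 hRT.2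
  · have hrec := recessionCone_inter hRp hTp ⟨_, hRT⟩
    have hface := isFace_recessionCone hRp hF
    obtain ⟨x, hx, hFx⟩ := (isConic_recessionCone R).isFace_iff.1 hface
    have hmem : a + b ∈ recessionCone (R ∩ T) := by rw [hrec]; exact ⟨hRab, hTab⟩
    rw [hFx] at hmem
    have hsum := hmem.2
    rw [map_add] at hsum
    have hxa := hx a hRa
    have hxb := hx b hRb
    have hsub : recessionCone (R ∩ T) ⊆ recessionCone T := by
      rw [hrec]; exact Set.inter_subset_right
    rw [hFx] at hsub
    exact hTcon ⟨hsub ⟨hRa, by linarith⟩, hsub ⟨hRb, by linarith⟩⟩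

/-- In a complete complex, the intersection of two recession cones is a face of each. -/
theorem isFace_recessionCone_inter [FiniteDimensional ℝ V] {C : Set (Set V)}
    (hC : C ∈ completeComplexes V) {P Q : Set V} (hP : P ∈ C) (hQ : Q ∈ C) :
    IsFace (recessionCone P ∩ recessionCone Q) (recessionCone P) := by
  have hcx := hC.1
  have hP' := isPolyhedron_recessionCone (hcx.isPolyhedron P hP) (hcx.nonempty_of_mem P hP)
  have hQ' := isPolyhedron_recessionCone (hcx.isPolyhedron Q hQ) (hcx.nonempty_of_mem Q hQ)
  have hPc := isConic_recessionCone P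
  have hQc := isConic_recessionCone Q
  refine isFace_of_extreme hPc hP' Set.inter_subset_left
    ⟨⟨0, hPc.zero_mem, hQc.zero_mem⟩, fun r hr u hu => ⟨hPc.2 r hr u hu.1, hQc.2 r hr u hu.2⟩⟩
    (fun u hu v hv => ⟨hPc.add_mem hP' hu.1 hv.1, hQc.add_mem hQ' hu.2 hv.2⟩)
    fun u hu v hv huv => ⟨hv, (mem_recessionCone_of_add_mem hC hP hQ hu hv huv.2).2⟩

theorem exists_mem_coneOver_of_complete [FiniteDimensional ℝ V] {C : Set (Set V)}
    (hC : C ∈ completeComplexes V) {z : V × ℝ} (hz : 0 ≤ z.2) : ∃ P ∈ C, z ∈ coneOver P := by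
  have hclosed : IsClosed (⋃ P ∈ C, coneOver P) :=
    hC.1.finite.isClosed_biUnion fun P _ => isClosed_closure
  -- Positive heights are covered by rescaling to height one; height zero follows since a finite
  -- union of closed cones is closed.
  have hmem : ∀ᶠ ε : ℝ in 𝓝[>] 0, (z.1, z.2 + ε) ∈ ⋃ P ∈ C, coneOver P := by
    filter_upwards [self_mem_nhdsWithin] with ε hε
    have hs : 0 < z.2 + ε := add_pos_of_nonneg_of_pos hz hε
    obtain ⟨P, hP, h⟩ := exists_mem_of_complete hC ((z.2 + ε)⁻¹ • z.1)
    exact Set.mem_biUnion hP ((mem_coneOver (hC.1.isPolyhedron P hP) ⟨_, h⟩).2 (Or.inl ⟨hs, h⟩))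
  have hcont : Continuous fun ε : ℝ => (z.1, z.2 + ε) := by fun_prop
  have := hclosed.mem_of_tendsto
    (by simpa using (hcont.tendsto 0).mono_left nhdsWithin_le_nhds) hmem
  simpa using this

theorem coneOver_mem_coneComplex {V : Type*} [AddCommGroup V] [Module ℝ V] [TopologicalSpace V]
    {C : Set (Set V)} {P : Set V} (hP : P ∈ C) : coneOver P ∈ coneComplex C :=
  Or.inl ⟨P, hP, rfl⟩

theorem prod_zero_mem_coneComplex {V : Type*} [AddCommGroup V] [Module ℝ V] [TopologicalSpace V]
    {C : Set (Set V)} {P : Set V} (hP : P ∈ C) :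
    recessionCone P ×ˢ ({0} : Set ℝ) ∈ coneComplex C :=
  Or.inr ⟨_, ⟨P, hP, rfl⟩, rfl⟩

theorem forall_mem_coneComplex {V : Type*} [AddCommGroup V] [Module ℝ V] [TopologicalSpace V]
    {C : Set (Set V)} {p : Set (V × ℝ) → Prop} (h1 : ∀ P ∈ C, p (coneOver P))
    (h2 : ∀ P ∈ C, p (recessionCone P ×ˢ ({0} : Set ℝ))) : ∀ s ∈ coneComplex C, p s := by
  rintro _ (⟨P, hP, rfl⟩ | ⟨_, ⟨P, hP, rfl⟩, rfl⟩)
  exacts [h1 P hP, h2 P hP]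

theorem isFace_prod_zero_inter [FiniteDimensional ℝ V] {C : Set (Set V)}
    (hC : C ∈ completeComplexes V) {P Q : Set V} (hP : P ∈ C) (hQ : Q ∈ C) :
    IsFace ((recessionCone P ∩ recessionCone Q) ×ˢ ({0} : Set ℝ)) (coneOver P) ∧
      IsFace ((recessionCone P ∩ recessionCone Q) ×ˢ ({0} : Set ℝ))
        (recessionCone P ×ˢ ({0} : Set ℝ)) := by
  have hface := isFace_recessionCone_inter hC hP hQ
  refine ⟨?_, isFace_prod_zero (isConic_recessionCone P) hface⟩
  obtain ⟨F, hF, hFG⟩ := exists_face_recessionCone_eq (hC.1.isPolyhedron P hP)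
    (hC.1.nonempty_of_mem P hP) hface
  rw [← hFG]
  exact isFace_prod_zero_coneOver (hC.1.isPolyhedron P hP) hF

theorem coneComplex_mem [FiniteDimensional ℝ V] {C : Set (Set V)}
    (hC : C ∈ completeComplexes V) : coneComplex C ∈ completeConicComplexes V := by
  have hcx := hC.1
  have hpoly := hcx.isPolyhedron
  have hne := hcx.nonempty_of_mem
  have hconic : ∀ s ∈ coneComplex C, IsConic s :=
    forall_mem_coneComplex (fun P hP => isConic_coneOver (hpoly P hP) (hne P hP))
      (fun P _ => isConic_prod_zero (isConic_recessionCone P))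
  refine ⟨⟨⟨?_, ?_, ?_, fun s hs => (hconic s hs).1, ?_, ?_⟩, hconic⟩, ?_⟩
  · exact (hcx.finite.image _).union ((hcx.finite.image _).image _)
  · obtain ⟨P, hP⟩ := hcx.nonempty
    exact ⟨_, coneOver_mem_coneComplex hP⟩
  · exact forall_mem_coneComplex (fun P hP => isPolyhedron_coneOver (hpoly P hP) (hne P hP))
      (fun P hP => isPolyhedron_recessionCone_prod_zero (hpoly P hP) (hne P hP))
  · refine forall_mem_coneComplex (fun P hP G hG => ?_) (fun P hP G hG => ?_)
    · obtain ⟨F, hF, rfl | rfl⟩ := exists_of_isFace_coneOver (hpoly P hP) (hne P hP) hG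
      · exact coneOver_mem_coneComplex (hcx.face_mem P hP F hF)
      · exact prod_zero_mem_coneComplex (hcx.face_mem P hP F hF)
    · obtain ⟨G', hG', rfl⟩ := exists_of_isFace_prod_zero (isConic_recessionCone P) hG
      obtain ⟨F, hF, rfl⟩ := exists_face_recessionCone_eq (hpoly P hP) (hne P hP) hG'
      exact prod_zero_mem_coneComplex (hcx.face_mem P hP F hF)
  -- Except for the cones over two cells that meet, every intersection is `rec P ∩ rec Q` at height
  -- zero.
  · refine forall_mem_coneComplex (fun P hP => ?_) (fun P hP => ?_) <;>
      refine forall_mem_coneComplex (fun Q hQ => Or.inr ?_) (fun Q hQ => Or.inr ?_) <;>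
      have h1 := isFace_prod_zero_inter hC hP hQ <;>
      have h2 := isFace_prod_zero_inter hC hQ hP <;>
      rw [Set.inter_comm (recessionCone Q)] at h2
    · rcases hcx.inter P hP Q hQ with hd | ⟨hF, hF'⟩
      · rw [coneOver_inter_of_disjoint (hpoly P hP) (hpoly Q hQ) (hne P hP) (hne Q hQ) hd]
        exact ⟨h1.1, h2.1⟩
      · rw [coneOver_inter (hpoly P hP) (hpoly Q hQ) (hF.isPolyhedron (hpoly P hP)) hF.1]
        exact ⟨isFace_coneOver (hpoly P hP) hF, isFace_coneOver (hpoly Q hQ) hF'⟩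
    · rw [coneOver_inter_prod_zero (hpoly P hP) (hne P hP)]
      exact ⟨h1.1, h2.2⟩
    · rw [Set.inter_comm, coneOver_inter_prod_zero (hpoly Q hQ) (hne Q hQ),
        Set.inter_comm (recessionCone Q)]
      exact ⟨h1.2, h2.1⟩
    · rw [← Set.inter_prod]
      exact ⟨h1.2, h2.2⟩
  · ext z
    simp only [support, Set.mem_iUnion, exists_prop, Set.mem_prod, Set.mem_univ, true_and,
      Set.mem_Ici]
    constructor
    · rintro ⟨s, hs, hz⟩
      revert s
      refine forall_mem_coneComplex (fun P hP hz => ?_) (fun P _ hz => hz.2.ge)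
      exact snd_nonneg_of_mem_coneOver (hpoly P hP) (hne P hP) hz
    · intro hz
      obtain ⟨P, hP, h⟩ := exists_mem_coneOver_of_complete hC hz
      exact ⟨_, coneOver_mem_coneComplex hP, h⟩

theorem affComplex_coneComplex [FiniteDimensional ℝ V] {C : Set (Set V)}
    (hC : C ∈ completeComplexes V) : affComplex (coneComplex C) = C := by
  have hslice : ∀ P ∈ C, {u | (u, (1 : ℝ)) ∈ coneOver P} = P := fun P hP =>
    Set.ext fun u => mk_one_mem_coneOver (hC.1.isPolyhedron P hP) (hC.1.nonempty_of_mem P hP)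
  ext P
  constructor
  · rintro ⟨hne, s, hs, rfl⟩
    revert s
    refine forall_mem_coneComplex (fun P hP _ => ?_) (fun P _ hne => ?_)
    · rwa [hslice P hP]
    · obtain ⟨u, hu⟩ := hne
      exact absurd hu.2 one_ne_zero
  · intro hP
    exact ⟨hC.1.nonempty_of_mem P hP, _, coneOver_mem_coneComplex hP, (hslice P hP).symm⟩

theorem snd_nonneg_of_mem {V : Type*} [AddCommGroup V] [Module ℝ V] {S : Set (Set (V × ℝ))}
    (hS : S ∈ completeConicComplexes V) {s : Set (V × ℝ)} (hs : s ∈ S) {z : V × ℝ}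
    (hz : z ∈ s) : 0 ≤ z.2 := by
  have : z ∈ support S := Set.mem_biUnion hs hz
  rw [hS.2] at this
  exact this.2

theorem coneOver_slice_of_mem [FiniteDimensional ℝ V] {S : Set (Set (V × ℝ))}
    (hS : S ∈ completeConicComplexes V) {s : Set (V × ℝ)} (hs : s ∈ S)
    (hne : {u | (u, (1 : ℝ)) ∈ s}.Nonempty) : coneOver {u | (u, (1 : ℝ)) ∈ s} = s :=
  coneOver_slice (hS.1.1.isPolyhedron s hs) (hS.1.2 s hs) (fun _ hz => snd_nonneg_of_mem hS hs hz)
    hne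

theorem coneOver_mem_of_mem_affComplex [FiniteDimensional ℝ V] {S : Set (Set (V × ℝ))}
    (hS : S ∈ completeConicComplexes V) {P : Set V} (hP : P ∈ affComplex S) :
    IsPolyhedron P ∧ coneOver P ∈ S := by
  obtain ⟨hne, s, hs, rfl⟩ := hP
  rw [coneOver_slice_of_mem hS hs hne]
  exact ⟨isPolyhedron_slice (hS.1.1.isPolyhedron s hs), hs⟩

theorem mem_affComplex_of_coneOver_mem [FiniteDimensional ℝ V] {S : Set (Set (V × ℝ))}
    {P : Set V} (hP : IsPolyhedron P) (hne : P.Nonempty) (h : coneOver P ∈ S) :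
    P ∈ affComplex S :=
  ⟨hne, _, h, Set.ext fun _ => (mk_one_mem_coneOver hP hne).symm⟩

theorem affComplex_mem [FiniteDimensional ℝ V] {S : Set (Set (V × ℝ))}
    (hS : S ∈ completeConicComplexes V) : affComplex S ∈ completeComplexes V := by
  have hcov : ∀ u : V, ∃ P ∈ affComplex S, u ∈ P := by
    intro u
    have : (u, (1 : ℝ)) ∈ support S := by rw [hS.2]; simp
    simp only [support, Set.mem_iUnion, exists_prop] at this
    obtain ⟨s, hs, hu⟩ := this
    exact ⟨{u | (u, (1 : ℝ)) ∈ s}, ⟨⟨u, hu⟩, s, hs, rfl⟩, hu⟩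
  refine ⟨⟨?_, ?_, fun P hP => (coneOver_mem_of_mem_affComplex hS hP).1, fun P hP => hP.1, ?_, ?_⟩,
    ?_⟩
  · refine (hS.1.1.finite.image fun s => {u | (u, (1 : ℝ)) ∈ s}).subset ?_
    rintro P ⟨-, s, hs, rfl⟩
    exact ⟨s, hs, rfl⟩
  · obtain ⟨P, hP, -⟩ := hcov 0
    exact ⟨P, hP⟩
  · intro P hP F hF
    obtain ⟨hPp, hPS⟩ := coneOver_mem_of_mem_affComplex hS hP
    exact mem_affComplex_of_coneOver_mem (hF.isPolyhedron hPp) hF.1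
      (hS.1.1.face_mem _ hPS _ (isFace_coneOver hPp hF))
  -- A point of `P ∩ Q` puts the common face at height one, which excludes the faces of the form
  -- `rec F × {0}`.
  · have key : ∀ P : Set V, IsPolyhedron P → P.Nonempty → ∀ Q : Set V, IsPolyhedron Q → Q.Nonempty →
        (P ∩ Q).Nonempty → IsFace (coneOver P ∩ coneOver Q) (coneOver P) → IsFace (P ∩ Q) P := by
      intro P hP hP' Q hQ hQ' hne hG
      obtain ⟨F, hF, hFG⟩ := exists_of_isFace_coneOver hP hP' hG
      have hmem : ∀ u, u ∈ P ∩ Q ↔ (u, (1 : ℝ)) ∈ coneOver P ∩ coneOver Q := fun u =>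
        and_congr (mk_one_mem_coneOver hP hP').symm (mk_one_mem_coneOver hQ hQ').symm
      rcases hFG with hFG | hFG
      · rw [hFG] at hmem
        have : P ∩ Q = F :=
          Set.ext fun u => (hmem u).trans (mk_one_mem_coneOver (hF.isPolyhedron hP) hF.1)
        rwa [this]
      · obtain ⟨u, hu⟩ := hne
        rw [hmem, hFG] at hu
        exact absurd hu.2 one_ne_zero
    intro P hP Q hQ
    rcases (P ∩ Q).eq_empty_or_nonempty with he | hne
    · exact Or.inl (Set.disjoint_iff_inter_eq_empty.2 he)
    obtain ⟨hPp, hPS⟩ := coneOver_mem_of_mem_affComplex hS hP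
    obtain ⟨hQp, hQS⟩ := coneOver_mem_of_mem_affComplex hS hQ
    rcases hS.1.1.inter _ hPS _ hQS with hd | ⟨hF, hF'⟩
    · exact absurd (isConic_coneOver hQp hQ.1).zero_mem
        (Set.disjoint_left.1 hd (isConic_coneOver hPp hP.1).zero_mem)
    · refine Or.inr ⟨key P hPp hP.1 Q hQp hQ.1 hne hF, ?_⟩
      rw [Set.inter_comm] at hne hF' ⊢
      exact key Q hQp hQ.1 P hPp hP.1 hne hF'
  · ext u
    simpa [support] using hcov u

theorem coneComplex_affComplex [FiniteDimensional ℝ V] {S : Set (Set (V × ℝ))}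
    (hS : S ∈ completeConicComplexes V) : coneComplex (affComplex S) = S := by
  have hA := affComplex_mem hS
  apply Set.Subset.antisymm
  · refine forall_mem_coneComplex
      (fun P hP => (coneOver_mem_of_mem_affComplex hS hP).2) (fun P hP => ?_)
    obtain ⟨hPp, hPS⟩ := coneOver_mem_of_mem_affComplex hS hP
    have hPP : IsFace P P := isFace_iff.2 ⟨hP.1, 0, 0, by simp, by simp⟩
    exact hS.1.1.face_mem _ hPS _ (isFace_prod_zero_coneOver hPp hPP)
  · intro s hs
    by_cases hne : {u | (u, (1 : ℝ)) ∈ s}.Nonempty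
    · rw [← coneOver_slice_of_mem hS hs hne]
      exact coneOver_mem_coneComplex ⟨hne, s, hs, rfl⟩
    · have hsc := hS.1.2 s hs
      -- The slices already form a complete complex, so the generic point `c` lies in some `coneOver
      -- P`. The face `s ∩ coneOver P` of `s` contains `c`, hence is all of `s`.
      obtain ⟨c, hc, hgen⟩ := exists_generic_mem_of_isConic hsc (hS.1.1.isPolyhedron s hs)
      obtain ⟨P, hP, hcP⟩ := exists_mem_coneOver_of_complete hA (snd_nonneg_of_mem hS hs hc)
      obtain ⟨hPp, hPS⟩ := coneOver_mem_of_mem_affComplex hS hP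
      rcases hS.1.1.inter s hs _ hPS with hd | ⟨hsP, hsP'⟩
      · exact absurd hcP (Set.disjoint_left.1 hd hc)
      rw [hgen _ hsP ⟨hc, hcP⟩] at hsP'
      obtain ⟨F, hF, rfl | rfl⟩ := exists_of_isFace_coneOver hPp hP.1 hsP'
      · obtain ⟨f, hf⟩ := hF.1
        exact absurd ⟨f, (mk_one_mem_coneOver (hF.isPolyhedron hPp) hF.1).2 hf⟩ hne
      · exact prod_zero_mem_coneComplex (hA.1.face_mem P hP F hF)

/-! ### Rationality and strong convexity -/

theorem exists_of_mem_prodLattice {V : Type*} [AddCommGroup V] {N : Submodule ℤ V}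
    {z : V × ℝ} (hz : z ∈ prodLattice N) : z.1 ∈ N ∧ ∃ n : ℤ, z.2 = n := by
  obtain ⟨h1, h2⟩ := Submodule.mem_prod.1 hz
  obtain ⟨n, hn⟩ := Submodule.mem_span_singleton.1 h2
  exact ⟨h1, n, by simpa using hn.symm⟩

/-- Homogenizing turns the constant term into the coefficient of the height, so this uses
rationality of the constants as well as of the functionals. -/
theorem isRational_coneSystem {V : Type*} [AddCommGroup V] [Module ℝ V] {N : Submodule ℤ V}
    {H : Finset (Module.Dual ℝ V × ℝ)}
    (hH : ∀ h ∈ H, IsRationalFunctional N h.1 ∧ ∃ q : ℚ, h.2 = (q : ℝ)) :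
    ∀ h ∈ coneSystem H,
      IsRationalFunctional (prodLattice N) h.1 ∧ ∃ q : ℚ, h.2 = (q : ℝ) := by
  classical
  simp only [coneSystem, Finset.forall_mem_insert, Finset.forall_mem_image]
  refine ⟨⟨fun z hz => ?_, 0, by simp⟩, fun h hh => ⟨fun z hz => ?_, 0, by simp⟩⟩
  · obtain ⟨-, n, hn⟩ := exists_of_mem_prodLattice hz
    exact ⟨n, by simp [hn]⟩
  · obtain ⟨h1, n, hn⟩ := exists_of_mem_prodLattice hz
    obtain ⟨hN, b, hb⟩ := hH h hh
    obtain ⟨a, ha⟩ := hN _ h1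
    exact ⟨a - b * n, by simp [ha, hb, hn]⟩

theorem isRational_recessionSystem {V : Type*} [AddCommGroup V] [Module ℝ V] {N : Submodule ℤ V}
    {H : Finset (Module.Dual ℝ V × ℝ)}
    (hH : ∀ h ∈ H, IsRationalFunctional N h.1 ∧ ∃ q : ℚ, h.2 = (q : ℝ)) :
    ∀ h ∈ recessionSystem H,
      IsRationalFunctional (prodLattice N) h.1 ∧ ∃ q : ℚ, h.2 = (q : ℝ) := by
  classical
  rw [recessionSystem, Finset.forall_mem_insert]
  refine ⟨⟨fun z hz => ?_, 0, by simp⟩, isRational_coneSystem hH⟩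
  obtain ⟨-, n, hn⟩ := exists_of_mem_prodLattice hz
  exact ⟨-n, by simp [hn]⟩

theorem IsRationalPolyhedron.coneOver [FiniteDimensional ℝ V] {N : Submodule ℤ V} {P : Set V}
    (hP : IsRationalPolyhedron N P) (hne : P.Nonempty) :
    IsRationalPolyhedron (prodLattice N) (coneOver P) := by
  obtain ⟨H, hH, rfl⟩ := hP
  exact ⟨_, isRational_coneSystem hH, coneOver_solutionSet hne⟩

theorem IsRationalPolyhedron.recessionCone_prod_zero {N : Submodule ℤ V} {P : Set V}
    (hP : IsRationalPolyhedron N P) (hne : P.Nonempty) :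
    IsRationalPolyhedron (prodLattice N) (recessionCone P ×ˢ ({0} : Set ℝ)) := by
  obtain ⟨H, hH, rfl⟩ := hP
  exact ⟨_, isRational_recessionSystem hH, prod_zero_eq_solutionSet hne⟩

theorem IsRationalPolyhedron.slice {N : Submodule ℤ V} {s : Set (V × ℝ)}
    (hs : IsRationalPolyhedron (prodLattice N) s) :
    IsRationalPolyhedron N {u | (u, (1 : ℝ)) ∈ s} := by
  classical
  obtain ⟨H, hH, rfl⟩ := hs
  refine ⟨sliceSystem H, ?_, slice_solutionSet H⟩
  simp only [sliceSystem, Finset.forall_mem_image]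
  intro h hh
  obtain ⟨hN, b, hb⟩ := hH h hh
  constructor
  · intro u hu
    exact hN (u, 0) (Submodule.mem_prod.2 ⟨hu, zero_mem _⟩)
  -- The constant of the slice involves the value at `(0, 1)`, which is a lattice vector.
  · obtain ⟨a, ha⟩ := hN (0, 1)
      (Submodule.mem_prod.2 ⟨zero_mem _, Submodule.mem_span_singleton_self _⟩)
    exact ⟨b - a, by simp [ha, hb]⟩

theorem ContainsNoLine.eq_zero {V : Type*} [AddCommGroup V] [Module ℝ V] {P : Set V}
    (hP : ContainsNoLine P) (hne : P.Nonempty) {v : V}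
    (hv : v ∈ recessionCone P) (hv' : -v ∈ recessionCone P) : v = 0 := by
  obtain ⟨p, hp⟩ := hne
  by_contra h0
  refine hP ⟨p, v, h0, fun t => ?_⟩
  rcases le_total 0 t with ht | ht
  · exact add_smul_mem_of_mem_recessionCone hp hv ht
  · simpa using add_smul_mem_of_mem_recessionCone hp hv' (neg_nonneg.2 ht)

theorem containsNoLine_of_recessionCone {V : Type*} [AddCommGroup V] [Module ℝ V] {P : Set V}
    (hP : IsPolyhedron P)
    (h : ∀ v, v ∈ recessionCone P → -v ∈ recessionCone P → v = 0) : ContainsNoLine P := by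
  rintro ⟨p, v, hv, hline⟩
  have hp : p ∈ P := by simpa using hline 0
  refine hv (h v ((mem_recessionCone_iff_of_mem hP hp v).2 fun r _ => hline r)
    ((mem_recessionCone_iff_of_mem hP hp _).2 fun r _ => ?_))
  simpa using hline (-r)

theorem recessionCone_subset_of_isConic {V : Type*} [AddCommGroup V] [Module ℝ V] {P : Set V}
    (hP : IsConic P) : recessionCone P ⊆ P := fun u hu => by
  simpa using add_smul_mem_of_mem_recessionCone hP.zero_mem hu zero_le_one

/-- Opposite vectors in the upper halfspace have height zero, so a line in the cone yields opposite
recession directions of `P`. -/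
theorem ContainsNoLine.coneOver [FiniteDimensional ℝ V] {P : Set V} (hP : ContainsNoLine P)
    (hP' : IsPolyhedron P) (hne : P.Nonempty) : ContainsNoLine (coneOver P) := by
  refine containsNoLine_of_recessionCone (isPolyhedron_coneOver hP' hne) ?_
  rintro ⟨v, t⟩ h1 h2
  replace h1 := recessionCone_subset_of_isConic (isConic_coneOver hP' hne) h1
  replace h2 := recessionCone_subset_of_isConic (isConic_coneOver hP' hne) h2
  have ht1 : 0 ≤ t := snd_nonneg_of_mem_coneOver hP' hne h1
  have ht2 : 0 ≤ -t := snd_nonneg_of_mem_coneOver hP' hne h2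
  obtain rfl : t = 0 := by linarith
  rw [Prod.neg_mk, neg_zero] at h2
  rw [hP.eq_zero hne ((mk_zero_mem_coneOver hP' hne).1 h1)
    ((mk_zero_mem_coneOver hP' hne).1 h2)]
  rfl

theorem ContainsNoLine.mono {V : Type*} [AddCommGroup V] [Module ℝ V] {P Q : Set V}
    (hQ : ContainsNoLine Q) (h : P ⊆ Q) : ContainsNoLine P := by
  rintro ⟨p, v, hv, hline⟩
  exact hQ ⟨p, v, hv, fun t => h (hline t)⟩

theorem ContainsNoLine.slice {V : Type*} [AddCommGroup V] [Module ℝ V] {s : Set (V × ℝ)}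
    (hs : ContainsNoLine s) : ContainsNoLine {u | (u, (1 : ℝ)) ∈ s} := by
  rintro ⟨p, v, hv, hline⟩
  refine hs ⟨(p, 1), (v, 0), fun h => hv (Prod.ext_iff.1 h).1, fun t => ?_⟩
  simpa using hline t

end Complexes

end PolyComplex

theorem corollary3p10 {V : Type*} [NormedAddCommGroup V] [NormedSpace ℝ V]
    [FiniteDimensional ℝ V] (N : Submodule ℤ V) [DiscreteTopology N] [IsZLattice ℝ N] :
    Set.BijOn PolyComplex.coneComplex
      (PolyComplex.completeComplexes V) (PolyComplex.completeConicComplexes V) ∧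
    Set.BijOn PolyComplex.affComplex
      (PolyComplex.completeConicComplexes V) (PolyComplex.completeComplexes V) ∧
    Set.InvOn PolyComplex.affComplex PolyComplex.coneComplex
      (PolyComplex.completeComplexes V) (PolyComplex.completeConicComplexes V) ∧
    (∀ C ∈ PolyComplex.completeComplexes V,
      PolyComplex.IsRationalCollection N C →
        PolyComplex.IsRationalCollection (PolyComplex.prodLattice N)
          (PolyComplex.coneComplex C)) ∧
    (∀ C ∈ PolyComplex.completeComplexes V,
      PolyComplex.IsStronglyConvexCollection C →
        PolyComplex.IsStronglyConvexCollection (PolyComplex.coneComplex C)) ∧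
    (∀ S ∈ PolyComplex.completeConicComplexes V,
      PolyComplex.IsRationalCollection (PolyComplex.prodLattice N) S →
        PolyComplex.IsRationalCollection N (PolyComplex.affComplex S)) ∧
    (∀ S ∈ PolyComplex.completeConicComplexes V,
      PolyComplex.IsStronglyConvexCollection S →
        PolyComplex.IsStronglyConvexCollection (PolyComplex.affComplex S)) := by
  open PolyComplex in
  have hinv : Set.InvOn (affComplex (V := V)) coneComplex
      (completeComplexes V) (completeConicComplexes V) :=
    ⟨fun C hC => affComplex_coneComplex hC, fun S hS => coneComplex_affComplex hS⟩
  have hcone : Set.MapsTo coneComplex (completeComplexes V) (completeConicComplexes V) :=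
    fun C hC => coneComplex_mem hC
  have haff : Set.MapsTo affComplex (completeConicComplexes V) (completeComplexes V) :=
    fun S hS => affComplex_mem hS
  refine ⟨hinv.bijOn hcone haff, hinv.symm.bijOn haff hcone, hinv, ?_, ?_, ?_, ?_⟩
  · intro C hC hN
    exact forall_mem_coneComplex
      (fun P hP => (hN P hP).coneOver (hC.1.nonempty_of_mem P hP))
      (fun P hP => (hN P hP).recessionCone_prod_zero (hC.1.nonempty_of_mem P hP))
  · intro C hC hN
    have h : ∀ P ∈ C, ContainsNoLine (coneOver P) := fun P hP =>
      (hN P hP).coneOver (hC.1.isPolyhedron P hP) (hC.1.nonempty_of_mem P hP)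
    refine forall_mem_coneComplex h fun P hP => (h P hP).mono ?_
    rintro ⟨u, t⟩ ⟨hu, ht⟩
    obtain rfl : t = 0 := ht
    exact (mk_zero_mem_coneOver (hC.1.isPolyhedron P hP) (hC.1.nonempty_of_mem P hP)).2 hu
  · rintro S - hN P ⟨-, s, hs, rfl⟩
    exact (hN s hs).slice
  · rintro S - hN P ⟨-, s, hs, rfl⟩
    exact (hN s hs).slice
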